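/- For $n\ge 0$ let $\mathbb P_n$ be the set of the $4^n$ $n$-qubit Pauli strings $\sigma_1\otimes\cdots\otimes\sigma_n$, $\sigma_i\in\{I,X,Y,Z\}$, acting on $(\mathbb C^2)^{\otimes n}$. Let $\mathcal G\subseteq\mathbb P_n$ and let $\mathfrak g=\langle i\mathcal G\rangle_{\mathrm{Lie}}$ be its dynamical Lie algebra, i.e. the smallest real Lie algebra of matrices (with the commutator as bracket) that contains $iX$ for every $X\in\mathcal G$. The commutator graph of $\mathcal G$ has vertex set $\mathbb P_n$, and $p,q$ are joined by an edge if there are $X\in\mathcal G$ and $c\neq 0$ with $[p,X]=c\,q$. Suppose that $\mathfrak g$ has a real basis consisting of $i$ times Pauli strings, and that the space $\{L : [L,U]=0\ \ \forall\, U\in \exp\mathfrak g\}$ of linear symmetries has a complex basis consisting of Pauli strings. Let $G$ be the compact Lie group $\exp\mathfrak g$, i.e. the smallest closed subgroup of the unitary group $\mathbb U(2^n)$ that contains $\exp\mathfrak g$, with normalised Haar measure $\mu_G$. Then the second frame potential $$F^{(2)}_G=\int_G\int_G\bigl|\operatorname{tr}(UV^\dagger)\bigr|^{4}\,d\mu_G(U)\,d\mu_G(V)$$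 equals $$\#(\text{isolated vertices})\cdot\#(\text{connected components})$$ of the commutator graph of $\mathcal G$. The same holds if $\mu_G$ is replaced by any probability measure on $\mathbb U(2^n)$ that is concentrated on the set $\exp\mathfrak g$ and invariant under left translation by the elements of that set. -/

import Mathlib

open MeasureTheory
open scoped Matrix

attribute [local instance 100] LieRing.ofAssociativeRing

/-- Labels of the four single-qubit Pauli matrices. -/
inductive Pauli : Type
  | I
  | X
  | Y
  | Z
  deriving DecidableEq

instance instFintypePauli : Fintype Pauli where
  elems := {Pauli.I, Pauli.X, Pauli.Y, Pauli.Z}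
  complete a := by cases a <;> simp

/-- The single-qubit Pauli matrices. -/
noncomputable def Pauli.toMatrix : Pauli → Matrix (Fin 2) (Fin 2) ℂ
  | .I => !![1, 0; 0, 1]
  | .X => !![0, 1; 1, 0]
  | .Y => !![0, -Complex.I; Complex.I, 0]
  | .Z => !![1, 0; 0, -1]

/-- `n`-qubit Pauli strings: there are `4 ^ n` of them, one for each choice of a Pauli label on
each qubit (no scalar prefactors). -/
abbrev PauliString (n : ℕ) : Type := Fin n → Pauli

/-- The computational basis of the `n`-qubit space `(ℂ²)^{⊗ n}`. -/
abbrev Qubits (n : ℕ) : Type := Fin n → Fin 2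

/-- Operators on the `n`-qubit space, as matrices in the computational basis. -/
abbrev Op (n : ℕ) : Type := Matrix (Qubits n) (Qubits n) ℂ

/-- The unitary group `U(2 ^ n)`. -/
abbrev QubitUnitary (n : ℕ) : Type := Matrix.unitaryGroup (Qubits n) ℂ

/-- The operator `σ_{p 0} ⊗ ⋯ ⊗ σ_{p (n-1)}` represented by a Pauli string. -/
noncomputable def PauliString.toOp {n : ℕ} (p : PauliString n) : Op n :=
  Matrix.of fun x y => ∏ i, (p i).toMatrix (x i) (y i)

theorem Pauli.toMatrix_sq (a : Pauli) : a.toMatrix * a.toMatrix = 1 := by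
  cases a <;> ext i j <;> fin_cases i <;> fin_cases j <;>
    simp [Pauli.toMatrix, Matrix.mul_apply, Fin.sum_univ_two]

theorem Pauli.exists_sign (a b : Pauli) : ∃ s : ℂ, (s = 1 ∨ s = -1) ∧
    a.toMatrix * b.toMatrix = s • (b.toMatrix * a.toMatrix) := by
  cases a <;> cases b <;>
    first
    | (refine ⟨1, Or.inl rfl, ?_⟩
       ext i j
       fin_cases i <;> fin_cases j <;>
         simp [Pauli.toMatrix, Matrix.mul_apply, Fin.sum_univ_two]
       done)
    | (refine ⟨-1, Or.inr rfl, ?_⟩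
       ext i j
       fin_cases i <;> fin_cases j <;>
         simp [Pauli.toMatrix, Matrix.mul_apply, Fin.sum_univ_two])

theorem PauliString.toOp_mul_apply {n : ℕ} (p q : PauliString n) (x y : Qubits n) :
    (p.toOp * q.toOp) x y = ∏ i, ((p i).toMatrix * (q i).toMatrix) (x i) (y i) := by
  simp only [Matrix.mul_apply, PauliString.toOp, Matrix.of_apply, Finset.prod_univ_sum,
    Fintype.piFinset_univ, Finset.prod_mul_distrib]

theorem PauliString.toOp_sq {n : ℕ} (p : PauliString n) : p.toOp * p.toOp = 1 := by
  ext x y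
  rw [PauliString.toOp_mul_apply]
  simp only [Pauli.toMatrix_sq, Matrix.one_apply, funext_iff]
  by_cases h : ∀ i, x i = y i
  · simp [h]
  · rw [if_neg h]
    push Not at h
    obtain ⟨i, hi⟩ := h
    exact Finset.prod_eq_zero (Finset.mem_univ i) (if_neg hi)

theorem PauliString.commute_or_anticommute {n : ℕ} (p q : PauliString n) :
    p.toOp * q.toOp = q.toOp * p.toOp ∨ p.toOp * q.toOp = -(q.toOp * p.toOp) := by
  choose s hs h using fun i => Pauli.exists_sign (p i) (q i)
  have key : p.toOp * q.toOp = (∏ i, s i) • (q.toOp * p.toOp) := by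
    ext x y
    rw [Matrix.smul_apply, PauliString.toOp_mul_apply, PauliString.toOp_mul_apply, smul_eq_mul,
      ← Finset.prod_mul_distrib]
    refine Finset.prod_congr rfl fun i _ => ?_
    rw [h i]
    rfl
  have hprod : (∏ i, s i) = 1 ∨ (∏ i, s i) = -1 := by
    refine Finset.prod_induction s (fun z => z = 1 ∨ z = -1) ?_ (Or.inl rfl) fun i _ => hs i
    rintro a b (rfl | rfl) (rfl | rfl) <;> simp
  rcases hprod with h1 | h1 <;> rw [key, h1] <;> simp

/-- `[p, X] ∝ q` for Pauli strings `p`, `q`, `X`, with a nonzero factor of proportionality. -/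
def CommutatorStep {n : ℕ} (X p q : PauliString n) : Prop :=
  ∃ c : ℂ, c ≠ 0 ∧ ⁅p.toOp, X.toOp⁆ = c • q.toOp

theorem PauliString.anticommute_of_step {n : ℕ} {X p q : PauliString n}
    (h : CommutatorStep X p q) : p.toOp * X.toOp = -(X.toOp * p.toOp) := by
  rcases PauliString.commute_or_anticommute p X with h1 | h1
  · obtain ⟨c, hc, hcq⟩ := h
    rw [Ring.lie_def, h1, sub_self] at hcq
    have hq : q.toOp = 0 := (smul_eq_zero.mp hcq.symm).resolve_left hc
    have := PauliString.toOp_sq q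
    rw [hq, mul_zero] at this
    exact absurd this zero_ne_one
  · exact h1

theorem CommutatorStep.symm {n : ℕ} {X p q : PauliString n}
    (h : CommutatorStep X p q) : CommutatorStep X q p := by
  have ha := PauliString.anticommute_of_step h
  obtain ⟨c, hc, hcq⟩ := h
  have hX := PauliString.toOp_sq X
  refine ⟨4 * c⁻¹, by simp [hc], ?_⟩
  have hq : q.toOp = c⁻¹ • ((2 : ℂ) • (p.toOp * X.toOp)) := by
    rw [eq_inv_smul_iff₀ hc, ← hcq, Ring.lie_def, two_smul, sub_eq_add_neg, ← ha]
  have h1 : X.toOp * (p.toOp * X.toOp) = -p.toOp := by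
    rw [ha, mul_neg, ← mul_assoc, hX, one_mul]
  have h2 : p.toOp * X.toOp * X.toOp = p.toOp := by rw [mul_assoc, hX, mul_one]
  rw [Ring.lie_def, hq]
  simp only [smul_mul_assoc, mul_smul_comm, h1, h2]
  module

theorem CommutatorStep.irrefl {n : ℕ} {X p : PauliString n} : ¬ CommutatorStep X p p := by
  intro h
  have ha := PauliString.anticommute_of_step h
  obtain ⟨c, hc, hcq⟩ := h
  have hX := PauliString.toOp_sq X
  have hp := PauliString.toOp_sq p
  have h2 : (2 : ℂ) • (p.toOp * X.toOp) = c • p.toOp := by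
    rw [← hcq, Ring.lie_def, two_smul, sub_eq_add_neg, ← ha]
  have h3 : (2 : ℂ) • X.toOp = c • (1 : Op n) := by
    have := congrArg (fun M => p.toOp * M) h2
    simpa only [mul_smul_comm, ← mul_assoc, hp, one_mul] using this
  have h4 : X.toOp * p.toOp = p.toOp * X.toOp := by
    have e1 := congrArg (fun M => M * p.toOp) h3
    have e2 := congrArg (fun M => p.toOp * M) h3
    simp only [smul_mul_assoc, mul_smul_comm, one_mul, mul_one] at e1 e2
    exact smul_right_injective _ (two_ne_zero : (2 : ℂ) ≠ 0) (e1.trans e2.symm)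
  rw [Ring.lie_def, h4, sub_self] at hcq
  have hq : p.toOp = 0 := (smul_eq_zero.mp hcq.symm).resolve_left hc
  rw [hq, mul_zero] at hp
  exact zero_ne_one hp

/-- The commutator graph of a set `𝒢` of Pauli strings: its vertices are all `n`-qubit Pauli
strings, and `p`, `q` are adjacent iff `[p, X] ∝ q` for some `X ∈ 𝒢`. -/
def commutatorGraph {n : ℕ} (𝒢 : Set (PauliString n)) : SimpleGraph (PauliString n) where
  Adj p q := ∃ X ∈ 𝒢, CommutatorStep X p q
  symm := ⟨fun _ _ ⟨X, hX, h⟩ => ⟨X, hX, h.symm⟩⟩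
  loopless := ⟨fun _ ⟨_, _, h⟩ => h.irrefl⟩

/-- The dynamical Lie algebra `⟨i 𝒢⟩_Lie`: the smallest real Lie algebra of operators (with the
commutator as bracket) that contains `i X` for all `X ∈ 𝒢`. -/
noncomputable def dla {n : ℕ} (𝒢 : Set (PauliString n)) : LieSubalgebra ℝ (Op n) :=
  LieSubalgebra.lieSpan ℝ (Op n) ((fun p : PauliString n => Complex.I • p.toOp) '' 𝒢)

/-- The set `exp 𝔤` of unitaries. (If `𝔤` consists of skew-Hermitian operators, as every dynamical
Lie algebra does, this is the set of all exponentials of elements of `𝔤`.) -/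
noncomputable def expSet {n : ℕ} (𝔤 : LieSubalgebra ℝ (Op n)) : Set (QubitUnitary n) :=
  {u | ∃ A ∈ 𝔤, (u : Op n) = NormedSpace.exp A}

/-- A real Lie algebra of skew-Hermitian operators has a basis consisting of (`i` times) Pauli
strings. -/
def HasPauliBasis {n : ℕ} (𝔤 : LieSubalgebra ℝ (Op n)) : Prop :=
  ∃ B : Set (PauliString n), LinearIndepOn ℝ (fun p : PauliString n => Complex.I • p.toOp) B ∧
    Submodule.span ℝ ((fun p : PauliString n => Complex.I • p.toOp) '' B) = 𝔤.toSubmodule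

/-- The linear symmetries of a set `E` of unitaries: the operators `L` with `[L, u] = 0` for all
`u ∈ E`. -/
noncomputable def linearSymmetries {n : ℕ} (E : Set (QubitUnitary n)) : Submodule ℂ (Op n) where
  carrier := {L | ∀ u ∈ E, L * (u : Op n) = (u : Op n) * L}
  add_mem' := fun ha hb u hu => by rw [add_mul, mul_add, ha u hu, hb u hu]
  zero_mem' := fun u _ => by rw [zero_mul, mul_zero]
  smul_mem' := fun c L hL u hu => by rw [smul_mul_assoc, mul_smul_comm, hL u hu]

/-- A complex space of operators has a basis consisting of Pauli strings. -/
def SpaceHasPauliBasis {n : ℕ} (W : Submodule ℂ (Op n)) : Prop :=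
  ∃ B : Set (PauliString n), LinearIndepOn ℂ (fun p : PauliString n => p.toOp) B ∧
    Submodule.span ℂ ((fun p : PauliString n => p.toOp) '' B) = W

/-- The Borel σ-algebra on the unitary group. -/
noncomputable instance instMeasurableSpaceU (n : ℕ) : MeasurableSpace (QubitUnitary n) := borel _

instance instBorelSpaceU (n : ℕ) : BorelSpace (QubitUnitary n) := ⟨rfl⟩

instance instCompactSpaceU (n : ℕ) : CompactSpace (QubitUnitary n) := by
  have hc : IsClosed ((Matrix.unitaryGroup (Qubits n) ℂ : Submonoid (Op n)) : Set (Op n)) :=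
    isClosed_unitary
  have hb : IsCompact (Set.univ.pi fun _ : Qubits n => Set.univ.pi fun _ : Qubits n =>
      Metric.closedBall (0 : ℂ) 1) :=
    isCompact_univ_pi fun _ => isCompact_univ_pi fun _ => isCompact_closedBall _ _
  refine isCompact_iff_compactSpace.mp (hb.of_isClosed_subset hc ?_)
  intro u hu i _ j _
  simpa using entry_norm_bound_of_unitary hu i j

/-- The compact Lie group of a Lie algebra `𝔤` of skew-Hermitian operators: the smallest closed
subgroup of the unitary group that contains `exp 𝔤`. (It equals `exp 𝔤` as soon as `exp 𝔤` is a
closed subgroup.) -/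
noncomputable def compactGroup {n : ℕ} (𝔤 : LieSubalgebra ℝ (Op n)) : Subgroup (QubitUnitary n) :=
  (Subgroup.closure (expSet 𝔤)).topologicalClosure

instance instCompactSpaceCompactGroup {n : ℕ} (𝔤 : LieSubalgebra ℝ (Op n)) :
    CompactSpace (compactGroup 𝔤) :=
  isCompact_iff_compactSpace.mp (Subgroup.isClosed_topologicalClosure _).isCompact

/-- The ensemble of Haar random elements of a compact subgroup of the unitary group: its
normalised Haar measure, as a measure on the unitary group. -/
noncomputable def haarEnsemble {n : ℕ} (G : Subgroup (QubitUnitary n)) [CompactSpace G] : Measure (QubitUnitary n) :=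
  (Measure.haarMeasure (⊤ : TopologicalSpace.PositiveCompacts G)).map Subtype.val

/-- `μ` is a uniform (Haar) distribution on the set `G` of unitaries: a probability measure that
is concentrated on `G` and invariant under left translation by the elements of `G`. -/
structure IsUniformOn {n : ℕ} (μ : Measure (QubitUnitary n)) (G : Set (QubitUnitary n)) : Prop where
  isProbabilityMeasure : IsProbabilityMeasure μ
  compl_eq_zero : μ Gᶜ = 0
  map_mul_left : ∀ u ∈ G, μ.map (fun v => u * v) = μ

/-- The `k`-th frame potential `𝔼_{u, v ∼ μ} |tr (u v†)| ^ (2 k)` of an ensemble of unitaries. -/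
noncomputable def framePotential {n : ℕ} (k : ℕ) (μ : Measure (QubitUnitary n)) : ℝ :=
  ∫ u, ∫ v, ‖Matrix.trace ((u : Op n) * (v : Op n)ᴴ)‖ ^ (2 * k) ∂μ ∂μ

/-! Invariance reduces the double integral to `∫ |tr u| ^ 4`. This integrand is the character of the
unitary group acting on `End (Op n)` by conjugation with `Ad u : A ↦ u A uᴴ`. The mean of a
character is the dimension of the fixed space (`integral_trace_eq_finrank_fixed`), here the space of
linear maps `T` on operators that commute with every `Ad u`. By `conjCommutant_expSet_dla` these are
the `T` that commute with `[·, X]` for all `X ∈ 𝒢`.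

Such a `T` can be written down. For a Pauli string `p` the operator `T p * p` commutes with `𝒢`, and
it does not change along an edge of the commutator graph. Hence `T` is left multiplication by one
element of the commutant of `𝒢` on each connected component, and these elements are arbitrary
(`adCommutantEquiv`). The commutant has the isolated vertices as a basis, so the dimension is the
product of the two numbers. -/

/-! ### Products and trace orthogonality of Pauli strings. -/

theorem Pauli.exists_mul (a b : Pauli) : ∃ s : ℂ, s ≠ 0 ∧ ∃ c : Pauli,
    a.toMatrix * b.toMatrix = s • c.toMatrix := by
  let t : Pauli → Pauli → ℂ × Pauli
    | .I, b => (1, b)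
    | a, .I => (1, a)
    | .X, .X | .Y, .Y | .Z, .Z => (1, .I)
    | .X, .Y => (Complex.I, .Z)
    | .Y, .Z => (Complex.I, .X)
    | .Z, .X => (Complex.I, .Y)
    | .Y, .X => (-Complex.I, .Z)
    | .Z, .Y => (-Complex.I, .X)
    | .X, .Z => (-Complex.I, .Y)
  refine ⟨(t a b).1, ?_, (t a b).2, ?_⟩
  · cases a <;> cases b <;> simp [t]
  · cases a <;> cases b <;> ext i j <;> fin_cases i <;> fin_cases j <;>
      simp [t, Pauli.toMatrix, Matrix.mul_apply, Fin.sum_univ_two]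

theorem Pauli.trace_mul (a b : Pauli) :
    (a.toMatrix * b.toMatrix).trace = if a = b then 2 else 0 := by
  cases a <;> cases b <;>
    simp [Pauli.toMatrix, Matrix.trace, Fin.sum_univ_two] <;> norm_num

theorem Pauli.star_toMatrix_apply (a : Pauli) (i j : Fin 2) :
    star (a.toMatrix j i) = a.toMatrix i j := by
  cases a <;> fin_cases i <;> fin_cases j <;> simp [Pauli.toMatrix]

namespace PauliString

variable {n : ℕ}

theorem conjTranspose_toOp (p : PauliString n) : p.toOpᴴ = p.toOp := by
  ext x y
  simp only [Matrix.conjTranspose_apply, toOp, Matrix.of_apply, star_prod,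
    Pauli.star_toMatrix_apply]

theorem exists_mul (p q : PauliString n) :
    ∃ s : ℂ, s ≠ 0 ∧ ∃ r : PauliString n, p.toOp * q.toOp = s • r.toOp := by
  choose s hs r h using fun i => Pauli.exists_mul (p i) (q i)
  refine ⟨∏ i, s i, Finset.prod_ne_zero_iff.mpr fun i _ => hs i, r, ?_⟩
  ext x y
  rw [toOp_mul_apply, Matrix.smul_apply, toOp, Matrix.of_apply, smul_eq_mul,
    ← Finset.prod_mul_distrib]
  refine Finset.prod_congr rfl fun i _ => ?_
  rw [h i]
  rfl

theorem trace_mul (p q : PauliString n) :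
    (p.toOp * q.toOp).trace = if p = q then 2 ^ n else 0 := by
  have h : (p.toOp * q.toOp).trace = ∏ i, ((p i).toMatrix * (q i).toMatrix).trace := by
    simp only [Matrix.trace, Matrix.diag_apply, toOp_mul_apply]
    rw [Finset.prod_univ_sum, Fintype.piFinset_univ]
  rw [h]
  simp only [Pauli.trace_mul]
  split_ifs with hpq
  · subst hpq
    simp
  · obtain ⟨i, hi⟩ := Function.ne_iff.mp hpq
    exact Finset.prod_eq_zero (Finset.mem_univ i) (if_neg hi)

theorem linearIndependent_toOp : LinearIndependent ℂ (fun p : PauliString n => p.toOp) := by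
  rw [Fintype.linearIndependent_iff]
  intro g hg p
  have h := congrArg (fun A : Op n => (A * p.toOp).trace) hg
  simp only [Finset.sum_mul, Matrix.trace_sum, smul_mul_assoc, Matrix.trace_smul, trace_mul,
    zero_mul, Matrix.trace_zero, smul_eq_mul, mul_ite, mul_zero, Finset.sum_ite_eq',
    Finset.mem_univ, if_true] at h
  exact (mul_eq_zero.mp h).resolve_right (by simp)

/-- The Pauli strings, as a basis of the space of operators. -/
noncomputable def opBasis (n : ℕ) : Module.Basis (PauliString n) ℂ (Op n) :=
  have : Nonempty (PauliString n) := ⟨fun _ => Pauli.I⟩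
  basisOfLinearIndependentOfCardEqFinrank linearIndependent_toOp (by
    have h4 : Fintype.card Pauli = 4 := rfl
    rw [Module.finrank_matrix]
    simp [h4, ← mul_pow])

@[simp]
theorem opBasis_apply (p : PauliString n) : opBasis n p = p.toOp := by
  simp [opBasis]

/-! ### Isolated vertices and the commutant. -/

/-- If `p` and `X` do not commute they anticommute, so `[p, X] = 2 p X` is a nonzero multiple of a
Pauli string, which is then a neighbour of `p`. -/
theorem isIsolated_iff {𝒢 : Set (PauliString n)} {p : PauliString n} :
    (commutatorGraph 𝒢).IsIsolated p ↔ ∀ X ∈ 𝒢, Commute p.toOp X.toOp := by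
  constructor
  · intro h X hX
    refine (commute_or_anticommute p X).resolve_right fun ha => ?_
    obtain ⟨s, hs, q, hq⟩ := exists_mul p X
    refine h q ⟨X, hX, 2 * s, by simp [hs], ?_⟩
    rw [Ring.lie_def, ← neg_eq_iff_eq_neg.mpr ha, sub_neg_eq_add, hq]
    module
  · rintro h q ⟨X, hX, c, hc, hcq⟩
    rw [Ring.lie_def, (h X hX).eq, sub_self] at hcq
    have hq := (smul_eq_zero.mp hcq.symm).resolve_left hc
    have := toOp_sq q
    rw [hq, mul_zero] at this
    exact zero_ne_one this

/-- The operators that commute with all elements of a set of Pauli strings. -/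
noncomputable def commutant (𝒢 : Set (PauliString n)) : Submodule ℂ (Op n) where
  carrier := {L | ∀ X ∈ 𝒢, L * X.toOp = X.toOp * L}
  add_mem' := fun ha hb u hu => by rw [add_mul, mul_add, ha u hu, hb u hu]
  zero_mem' := fun u _ => by rw [zero_mul, mul_zero]
  smul_mem' := fun c L hL u hu => by rw [smul_mul_assoc, mul_smul_comm, hL u hu]

/-- Conjugation by `X` is diagonal in the Pauli basis with eigenvalues `±1`. An element of the
commutant is fixed by it, so its coefficient vanishes at every `p` that anticommutes with some `X ∈
𝒢`. -/
theorem commutant_eq_span (𝒢 : Set (PauliString n)) :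
    commutant 𝒢 = Submodule.span ℂ
      (Set.range fun p : {p // (commutatorGraph 𝒢).IsIsolated p} => p.1.toOp) := by
  apply le_antisymm
  · intro L hL
    rw [← (opBasis n).sum_repr L]
    refine Submodule.sum_mem _ fun p _ => ?_
    by_cases hp : (commutatorGraph 𝒢).IsIsolated p
    · rw [opBasis_apply]
      exact Submodule.smul_mem _ _ (Submodule.subset_span ⟨⟨p, hp⟩, rfl⟩)
    · rw [isIsolated_iff] at hp
      push Not at hp
      obtain ⟨X, hX, hpX⟩ := hp
      choose s hs using fun q : PauliString n =>
        (show ∃ s : ℂ, X.toOp * q.toOp * X.toOp = s • q.toOp ∧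
            (¬ Commute q.toOp X.toOp → s = -1) by
          rcases commute_or_anticommute q X with h | h
          · exact ⟨1, by rw [mul_assoc, h, ← mul_assoc, toOp_sq, one_mul, one_smul],
              fun h' => absurd h h'⟩
          · exact ⟨-1, by
              rw [mul_assoc, h, mul_neg, ← mul_assoc, toOp_sq, one_mul, neg_smul, one_smul],
              fun _ => rfl⟩)
      have h1 : X.toOp * L * X.toOp = L := by
        rw [← hL X hX, mul_assoc, toOp_sq, mul_one]
      have h2 : (opBasis n).repr (X.toOp * L * X.toOp) p = s p * (opBasis n).repr L p := by
        conv_lhs => rw [← (opBasis n).sum_repr L]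
        simp only [Finset.mul_sum, Finset.sum_mul, mul_smul_comm, smul_mul_assoc, opBasis_apply,
          (hs _).1]
        simp only [← opBasis_apply, map_sum, map_smul, Module.Basis.repr_self]
        simp [Finsupp.finsetSum_apply, Finsupp.single_apply, mul_comm]
      rw [h1, (hs p).2 hpX] at h2
      have h3 : (opBasis n).repr L p = 0 := by linear_combination h2 / 2
      rw [h3, zero_smul]
      exact Submodule.zero_mem _
  · rw [Submodule.span_le]
    rintro _ ⟨⟨p, hp⟩, rfl⟩ X hX
    exact isIsolated_iff.mp hp X hX

theorem finrank_commutant (𝒢 : Set (PauliString n)) :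
    Module.finrank ℂ (commutant 𝒢) =
      {p : PauliString n | (commutatorGraph 𝒢).IsIsolated p}.ncard := by
  classical
  have h := finrank_span_eq_card (linearIndependent_toOp.comp
    (Subtype.val : {p : PauliString n // (commutatorGraph 𝒢).IsIsolated p} → PauliString n)
    Subtype.val_injective)
  rw [← Nat.card_eq_fintype_card] at h
  rw [commutant_eq_span]
  exact h

/-! ### Linear maps commuting with all `[·, X]`, component by component. -/

/-- The linear maps on operators that commute with `[·, X]` for all `X` in a set of Pauli
strings. -/
noncomputable def adCommutant (𝒢 : Set (PauliString n)) :
    Submodule ℂ (Module.End ℂ (Op n)) where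
  carrier := {T | ∀ X ∈ 𝒢, ∀ A, T (A * X.toOp - X.toOp * A) = T A * X.toOp - X.toOp * T A}
  add_mem' := fun ha hb X hX A => by
    simp only [LinearMap.add_apply, ha X hX A, hb X hX A, add_mul, mul_add]
    abel
  zero_mem' := fun X _ A => by simp
  smul_mem' := fun c T hT X hX A => by
    simp only [LinearMap.smul_apply, hT X hX A, smul_mul_assoc, mul_smul_comm, smul_sub]

/-- `T p` inherits from `p` its sign of commutation with `X`, so the two signs cancel in the
product. -/
theorem mul_mem_commutant {𝒢 : Set (PauliString n)} {T : Module.End ℂ (Op n)}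
    (hT : T ∈ adCommutant 𝒢) (p : PauliString n) : T p.toOp * p.toOp ∈ commutant 𝒢 := by
  intro X hX
  have hX2 := toOp_sq X
  rcases commute_or_anticommute p X with h | h
  · have h1 := hT X hX p.toOp
    rw [h, sub_self, map_zero] at h1
    rw [mul_assoc, h, ← mul_assoc, sub_eq_zero.mp h1.symm, mul_assoc]
  -- Here `[[p, X], X] = 4 p`. Applying `T` gives `4 T p = 2 T p - 2 X (T p) X`, so `T p`
  -- anticommutes with `X`.
  · have h1 := hT X hX p.toOp
    have h2 := hT X hX (p.toOp * X.toOp - X.toOp * p.toOp)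
    have e1 : p.toOp * X.toOp - X.toOp * p.toOp = (2 : ℂ) • (p.toOp * X.toOp) := by
      rw [two_smul, sub_eq_add_neg, ← h]
    have e2 : p.toOp * X.toOp * X.toOp - X.toOp * (p.toOp * X.toOp) = (2 : ℂ) • p.toOp := by
      rw [h, neg_mul, mul_neg, mul_assoc, ← mul_assoc, ← mul_assoc, hX2, one_mul, mul_assoc, h,
        mul_neg, ← mul_assoc, hX2, one_mul]
      module
    rw [h1, e1, smul_mul_assoc, mul_smul_comm, ← smul_sub, e2, map_smul, map_smul] at h2
    have h3 : X.toOp * T p.toOp * X.toOp = - T p.toOp := by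
      have : (T p.toOp * X.toOp - X.toOp * T p.toOp) * X.toOp
          - X.toOp * (T p.toOp * X.toOp - X.toOp * T p.toOp)
          = (2 : ℂ) • T p.toOp - (2 : ℂ) • (X.toOp * T p.toOp * X.toOp) := by
        rw [sub_mul, mul_sub, mul_assoc (T p.toOp), ← mul_assoc X.toOp X.toOp, hX2, mul_assoc]
        simp only [mul_one, one_mul]
        module
      rw [this] at h2
      have h4 : (2 : ℂ) • (X.toOp * T p.toOp * X.toOp) = (2 : ℂ) • (- T p.toOp) := by
        rw [smul_neg, ← sub_eq_zero]
        have h6 := sub_eq_zero.mpr h2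
        rw [← h6]
        module
      exact smul_right_injective _ (two_ne_zero : (2 : ℂ) ≠ 0) h4
    have h5 : T p.toOp * X.toOp = -(X.toOp * T p.toOp) := by
      have := congrArg (fun A => X.toOp * A) h3
      simp only [← mul_assoc, hX2, one_mul, mul_neg] at this
      exact this
    rw [mul_assoc, h, mul_neg, ← mul_assoc, h5, neg_mul, neg_neg, mul_assoc]

/-- Write `T p = L p` with `L` in the commutant. Then `T [p, X] = [L p, X] = L [p, X]`, and `[p, X]`
is a nonzero multiple of `q`. -/
theorem apply_mul_eq_of_adj {𝒢 : Set (PauliString n)} {T : Module.End ℂ (Op n)}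
    (hT : T ∈ adCommutant 𝒢) {p q : PauliString n} (h : (commutatorGraph 𝒢).Adj p q) :
    T p.toOp * p.toOp = T q.toOp * q.toOp := by
  obtain ⟨X, hX, h⟩ := h
  have ha := anticommute_of_step h
  obtain ⟨c, hc, hq⟩ := h
  have hX2 := toOp_sq X
  have hp2 := toOp_sq p
  have hL := mul_mem_commutant hT p X hX
  set L := T p.toOp * p.toOp with hLdef
  have hTp : T p.toOp = L * p.toOp := by rw [hLdef, mul_assoc, hp2, mul_one]
  have h1 := hT X hX p.toOp
  rw [Ring.lie_def] at hq
  have h2 : c • T q.toOp = c • (L * q.toOp) := by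
    rw [← map_smul, ← mul_smul_comm, ← hq, h1, hTp, mul_sub, ← mul_assoc X.toOp, ← hL,
      mul_assoc, mul_assoc, mul_assoc]
  have h3 := smul_right_injective _ hc h2
  rw [h3, mul_assoc, toOp_sq, mul_one]

theorem apply_mul_eq_of_reachable {𝒢 : Set (PauliString n)} {T : Module.End ℂ (Op n)}
    (hT : T ∈ adCommutant 𝒢) {p q : PauliString n} (h : (commutatorGraph 𝒢).Reachable p q) :
    T p.toOp * p.toOp = T q.toOp * q.toOp := by
  obtain ⟨w⟩ := h
  induction w with
  | nil => rfl
  | cons h _ ih => exact (apply_mul_eq_of_adj hT h).trans ih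

theorem constr_mem_adCommutant {𝒢 : Set (PauliString n)}
    (D : (commutatorGraph 𝒢).ConnectedComponent → commutant 𝒢) :
    (opBasis n).constr ℂ (fun p =>
      (D ((commutatorGraph 𝒢).connectedComponentMk p) : Op n) * p.toOp) ∈ adCommutant 𝒢 := by
  set T := (opBasis n).constr ℂ (fun p =>
    (D ((commutatorGraph 𝒢).connectedComponentMk p) : Op n) * p.toOp) with hTdef
  have hT (p : PauliString n) :
      T p.toOp = (D ((commutatorGraph 𝒢).connectedComponentMk p) : Op n) * p.toOp := by
    rw [hTdef, ← opBasis_apply, Module.Basis.constr_basis, opBasis_apply]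
  intro X hX A
  have key : T ∘ₗ (LinearMap.mulRight ℂ X.toOp - LinearMap.mulLeft ℂ X.toOp) =
      (LinearMap.mulRight ℂ X.toOp - LinearMap.mulLeft ℂ X.toOp) ∘ₗ T := by
    refine (opBasis n).ext fun p => ?_
    simp only [opBasis_apply, LinearMap.comp_apply, LinearMap.sub_apply, LinearMap.mulRight_apply,
      LinearMap.mulLeft_apply, hT]
    have hD := (D ((commutatorGraph 𝒢).connectedComponentMk p)).2 X hX
    rw [← mul_assoc X.toOp, ← hD, mul_assoc, mul_assoc, ← mul_sub]
    rcases commute_or_anticommute p X with h | h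
    · rw [h, sub_self, map_zero, mul_zero]
    · obtain ⟨s, hs, q, hq⟩ := exists_mul p X
      have hstep : p.toOp * X.toOp - X.toOp * p.toOp = (2 * s) • q.toOp := by
        rw [← neg_eq_iff_eq_neg.mpr h, sub_neg_eq_add, hq]
        module
      have hadj : (commutatorGraph 𝒢).Adj p q := ⟨X, hX, 2 * s, by simp [hs], hstep⟩
      rw [hstep, map_smul, hT, mul_smul_comm,
        SimpleGraph.ConnectedComponent.connectedComponentMk_eq_of_adj hadj]
  simpa using LinearMap.congr_fun key A

/-- A linear map commuting with all `[·, X]` acts on each component of the commutator graph as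
the left multiplication by an element of the commutant. -/
noncomputable def adCommutantEquiv (𝒢 : Set (PauliString n)) :
    adCommutant 𝒢 ≃ₗ[ℂ] ((commutatorGraph 𝒢).ConnectedComponent → commutant 𝒢) where
  toFun T C := ⟨T.1 C.out.toOp * C.out.toOp, mul_mem_commutant T.2 _⟩
  map_add' T T' := by
    ext1 C
    exact Subtype.ext (by simp [add_mul])
  map_smul' c T := by
    ext1 C
    exact Subtype.ext (by simp)
  invFun D := ⟨_, constr_mem_adCommutant D⟩
  left_inv T := by
    refine Subtype.ext ((opBasis n).ext fun p => ?_)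
    simp only [Module.Basis.constr_basis]
    rw [apply_mul_eq_of_reachable T.2 (p := Quot.out _) (q := p)
      (SimpleGraph.ConnectedComponent.exact (Quot.out_eq _)), mul_assoc, toOp_sq, mul_one,
      opBasis_apply]
  right_inv D := by
    ext1 C
    refine Subtype.ext ?_
    simp only
    rw [← opBasis_apply, Module.Basis.constr_basis, opBasis_apply, mul_assoc, toOp_sq, mul_one]
    congr 2
    exact Quot.out_eq _

theorem finrank_adCommutant (𝒢 : Set (PauliString n)) :
    Module.finrank ℂ (adCommutant 𝒢) =
      {p : PauliString n | (commutatorGraph 𝒢).IsIsolated p}.ncard *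
        Nat.card (commutatorGraph 𝒢).ConnectedComponent := by
  classical
  have : Fintype (commutatorGraph 𝒢).ConnectedComponent := Fintype.ofFinite _
  rw [(adCommutantEquiv 𝒢).finrank_eq, Module.finrank_pi_fintype]
  simp [finrank_commutant, mul_comm]

end PauliString

/-! ### Traces of two-sided multiplications and averages of representations. -/

theorem Matrix.trace_mulLeft_comp_mulRight {κ : Type*} [Fintype κ] [DecidableEq κ]
    (A B : Matrix κ κ ℂ) :
    LinearMap.trace ℂ (Matrix κ κ ℂ) (LinearMap.mulLeft ℂ A ∘ₗ LinearMap.mulRight ℂ B) =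
      A.trace * B.trace := by
  rw [LinearMap.trace_eq_matrix_trace ℂ (Matrix.stdBasis ℂ κ κ), Matrix.trace,
    Fintype.sum_prod_type, Matrix.trace, Matrix.trace, Finset.sum_mul_sum]
  refine Finset.sum_congr rfl fun i _ => Finset.sum_congr rfl fun j _ => ?_
  rw [Matrix.diag_apply, LinearMap.toMatrix_apply, Matrix.stdBasis_eq_single]
  simp only [LinearMap.comp_apply, LinearMap.mulLeft_apply, LinearMap.mulRight_apply]
  have : ∀ M : Matrix κ κ ℂ, (Matrix.stdBasis ℂ κ κ).repr M (i, j) = M i j := fun M => rfl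
  rw [this, ← mul_assoc]
  simp [Matrix.mul_apply, Matrix.single_apply, ite_and, Finset.sum_ite_eq, ite_mul]

theorem Module.End.trace_mulLeft_comp_mulRight {V : Type*} [AddCommGroup V] [Module ℂ V]
    [FiniteDimensional ℂ V] (A B : Module.End ℂ V) :
    LinearMap.trace ℂ (Module.End ℂ V) (LinearMap.mulLeft ℂ A ∘ₗ LinearMap.mulRight ℂ B) =
      LinearMap.trace ℂ V A * LinearMap.trace ℂ V B := by
  classical
  let b := Module.finBasis ℂ V
  rw [← LinearMap.trace_conj' _ (LinearMap.toMatrix b b), LinearMap.trace_eq_matrix_trace ℂ b,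
    LinearMap.trace_eq_matrix_trace ℂ b, ← Matrix.trace_mulLeft_comp_mulRight]
  congr 1
  refine LinearMap.ext fun M => ?_
  obtain ⟨T, rfl⟩ := (LinearMap.toMatrix b b).surjective M
  simp [LinearEquiv.conj_apply_apply, LinearMap.toMatrix_mul]

/-- The trace of the average of a representation is the dimension of its fixed space. -/
theorem integral_trace_eq_finrank_fixed {G : Type*} [Group G] [TopologicalSpace G]
    [IsTopologicalGroup G] [CompactSpace G] [MeasurableSpace G] [BorelSpace G]
    {κ : Type*} [Fintype κ] [DecidableEq κ]
    (ρ : G → Matrix κ κ ℂ) (hρ : ∀ g h, ρ (g * h) = ρ g * ρ h) (hc : Continuous ρ)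
    (μ : Measure G) [IsProbabilityMeasure μ] (E : Set G) (hE : μ Eᶜ = 0)
    (hμ : ∀ g ∈ E, μ.map (fun h => g * h) = μ) (F : Submodule ℂ (κ → ℂ))
    (hF : ∀ v, v ∈ F ↔ ∀ g ∈ E, ρ g *ᵥ v = v) :
    ∫ g, (ρ g).trace ∂μ = (Module.finrank ℂ F : ℂ) := by
  have hci : ∀ i j, Continuous fun g => ρ g i j := fun i j => hc.matrix_elem i j
  have hint : ∀ {f : G → ℂ}, Continuous f → Integrable f μ := fun hf =>
    hf.integrable_of_hasCompactSupport (HasCompactSupport.of_compactSpace _)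
  -- The averaged representation is a projection onto `F`, so its trace is the dimension. `E` need
  -- not be a subgroup: invariance puts the range of `P` in `F`, and concentration on `E` makes `P`
  -- the identity on `F`.
  let P : Matrix κ κ ℂ := Matrix.of fun i j => ∫ g, ρ g i j ∂μ
  have htr : ∫ g, (ρ g).trace ∂μ = P.trace := by
    simp only [Matrix.trace, Matrix.diag_apply]
    rw [integral_finsetSum _ fun i _ => hint (hci i i)]
    rfl
  have hmul : ∀ g ∈ E, ρ g * P = P := by
    intro g hg
    ext i j
    have h1 : P i j = ∫ h, ρ (g * h) i j ∂μ := by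
      have h2 := (Homeomorph.mulLeft g).toMeasurableEquiv.measurableEmbedding.integral_map
        (μ := μ) (fun h => ρ h i j)
      change ∫ h, ρ h i j ∂(μ.map (fun h => g * h)) = ∫ h, ρ (g * h) i j ∂μ at h2
      rw [hμ g hg] at h2
      exact h2
    rw [h1]
    simp only [hρ, Matrix.mul_apply]
    rw [integral_finsetSum _ fun k _ => (hint (hci k j)).const_mul _]
    simp only [integral_const_mul]
    rfl
  have hproj : LinearMap.IsProj F (Matrix.toLin' P) := by
    refine ⟨fun v => (hF _).mpr fun g hg => ?_, fun v hv => ?_⟩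
    · rw [Matrix.toLin'_apply, Matrix.mulVec_mulVec, hmul g hg]
    · ext i
      rw [Matrix.toLin'_apply]
      have h1 : (P *ᵥ v) i = ∫ g, (ρ g *ᵥ v) i ∂μ := by
        simp only [Matrix.mulVec, dotProduct]
        rw [integral_finsetSum _ fun k _ => (hint (hci i k)).mul_const _]
        simp only [integral_mul_const]
        rfl
      have h2 : ∀ᵐ g ∂μ, (ρ g *ᵥ v) i = v i := by
        have : ∀ᵐ g ∂μ, g ∈ E := hE
        filter_upwards [this] with g hg
        rw [(hF v).mp hv g hg]
      rw [h1, integral_congr_ae h2]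
      simp
  rw [htr, ← LinearMap.IsProj.trace hproj, Matrix.trace_toLin'_eq]

/-! ### The fourth moment of the trace as the dimension of a commutant. -/

section Conjugation

variable {n : ℕ}

/-- Conjugation by a unitary. -/
noncomputable def conjOp (u : QubitUnitary n) : Module.End ℂ (Op n) :=
  LinearMap.mulLeft ℂ (u : Op n) ∘ₗ LinearMap.mulRight ℂ ((u : Op n)ᴴ)

theorem conjOp_apply (u : QubitUnitary n) (A : Op n) :
    conjOp u A = (u : Op n) * A * (u : Op n)ᴴ := by
  simp [conjOp, mul_assoc]

theorem conjOp_mul (u v : QubitUnitary n) : conjOp (u * v) = conjOp u * conjOp v := by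
  refine LinearMap.ext fun A => ?_
  simp [conjOp_apply, Module.End.mul_apply, Matrix.conjTranspose_mul, mul_assoc]

theorem conjOp_one : conjOp (1 : QubitUnitary n) = 1 := by
  refine LinearMap.ext fun A => ?_
  simp [conjOp_apply]

theorem trace_conjOp (u : QubitUnitary n) :
    LinearMap.trace ℂ (Op n) (conjOp u) = (‖(u : Op n).trace‖ ^ 2 : ℝ) := by
  rw [conjOp, Matrix.trace_mulLeft_comp_mulRight, Matrix.trace_conjTranspose]
  simpa using Complex.mul_conj' (u : Op n).trace

theorem trace_conjOp_inv (u : QubitUnitary n) :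
    LinearMap.trace ℂ (Op n) (conjOp u⁻¹) = (‖(u : Op n).trace‖ ^ 2 : ℝ) := by
  rw [trace_conjOp]
  have : ((u⁻¹ : QubitUnitary n) : Op n) = (u : Op n)ᴴ := rfl
  rw [this, Matrix.trace_conjTranspose, norm_star]

theorem continuous_conjOp_apply (A : Op n) :
    Continuous fun u : QubitUnitary n => conjOp u A := by
  simp only [conjOp_apply]
  exact (continuous_subtype_val.mul continuous_const).mul
    continuous_subtype_val.matrix_conjTranspose

/-- The linear maps on operators that commute with the conjugation by elements of `E`. -/
noncomputable def conjCommutant (E : Set (QubitUnitary n)) :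
    Submodule ℂ (Module.End ℂ (Op n)) where
  carrier := {T | ∀ u ∈ E, conjOp u * T = T * conjOp u}
  add_mem' := fun ha hb u hu => by rw [add_mul, mul_add, ha u hu, hb u hu]
  zero_mem' := fun u _ => by rw [zero_mul, mul_zero]
  smul_mem' := fun c L hL u hu => by rw [smul_mul_assoc, mul_smul_comm, hL u hu]

/-- Conjugation by the conjugation by a unitary. -/
noncomputable def conjEnd (u : QubitUnitary n) : Module.End ℂ (Module.End ℂ (Op n)) :=
  LinearMap.mulLeft ℂ (conjOp u) ∘ₗ LinearMap.mulRight ℂ (conjOp u⁻¹)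

theorem conjEnd_apply (u : QubitUnitary n) (T : Module.End ℂ (Op n)) :
    conjEnd u T = conjOp u * T * conjOp u⁻¹ := by
  simp [conjEnd, mul_assoc]

theorem conjEnd_mul (u v : QubitUnitary n) : conjEnd (u * v) = conjEnd u * conjEnd v := by
  refine LinearMap.ext fun A => ?_
  simp only [conjEnd_apply, Module.End.mul_apply, mul_inv_rev, conjOp_mul, mul_assoc]

theorem conjEnd_apply_eq_iff (u : QubitUnitary n) (T : Module.End ℂ (Op n)) :
    conjEnd u T = T ↔ conjOp u * T = T * conjOp u := by
  have h1 : conjOp u⁻¹ * conjOp u = 1 := by rw [← conjOp_mul, inv_mul_cancel, conjOp_one]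
  have h2 : conjOp u * conjOp u⁻¹ = 1 := by rw [← conjOp_mul, mul_inv_cancel, conjOp_one]
  rw [conjEnd_apply]
  constructor
  · intro h
    conv_rhs => rw [← h, mul_assoc, h1, mul_one]
  · intro h
    rw [h, mul_assoc, h2, mul_one]

theorem trace_conjEnd (u : QubitUnitary n) :
    LinearMap.trace ℂ _ (conjEnd u) = (‖(u : Op n).trace‖ ^ 4 : ℝ) := by
  rw [conjEnd, Module.End.trace_mulLeft_comp_mulRight, trace_conjOp, trace_conjOp_inv]
  push_cast
  ring

/-- The matrix of `conjEnd u` has entries that are continuous in `u`. -/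
theorem continuous_toMatrix_conjEnd {κ : Type*} [Fintype κ] [DecidableEq κ]
    (b : Module.Basis κ ℂ (Module.End ℂ (Op n))) :
    Continuous fun u : QubitUnitary n => LinearMap.toMatrix b b (conjEnd u) := by
  let c := PauliString.opBasis n
  have hR : Continuous fun u : QubitUnitary n => LinearMap.toMatrix c c (conjOp u) := by
    refine continuous_matrix fun i j => ?_
    simp only [LinearMap.toMatrix_apply]
    exact (LinearMap.continuous_of_finiteDimensional (c.coord i)).comp
      (continuous_conjOp_apply (c j))
  refine continuous_matrix fun i j => ?_
  simp only [LinearMap.toMatrix_apply]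
  -- Each entry is a fixed linear functional of a product of matrices, in which only the matrices of
  -- `conjOp u` and `conjOp u⁻¹` depend on `u`.
  have h : ∀ u : QubitUnitary n, b.repr (conjEnd u (b j)) i =
      (b.coord i ∘ₗ (LinearMap.toMatrix c c).symm.toLinearMap)
        (LinearMap.toMatrix c c (conjOp u) * LinearMap.toMatrix c c (b j) *
          LinearMap.toMatrix c c (conjOp u⁻¹)) := by
    intro u
    rw [← LinearMap.toMatrix_mul, ← LinearMap.toMatrix_mul, ← conjEnd_apply]
    simp
  simp only [h]
  exact (LinearMap.continuous_of_finiteDimensional _).comp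
    ((hR.mul continuous_const).mul (hR.comp continuous_inv))

theorem integral_norm_trace_pow {μ : Measure (QubitUnitary n)} {E : Set (QubitUnitary n)}
    (hμ : IsUniformOn μ E) :
    ∫ u, ‖(u : Op n).trace‖ ^ 4 ∂μ = Module.finrank ℂ (conjCommutant E) := by
  classical
  have := hμ.isProbabilityMeasure
  let b := Module.finBasis ℂ (Module.End ℂ (Op n))
  have key := integral_trace_eq_finrank_fixed
    (fun u : QubitUnitary n => LinearMap.toMatrix b b (conjEnd u))
    (fun g h => by rw [conjEnd_mul, LinearMap.toMatrix_mul]) (continuous_toMatrix_conjEnd b)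
    μ E hμ.compl_eq_zero hμ.map_mul_left ((conjCommutant E).map b.equivFun.toLinearMap) (by
      intro v
      obtain ⟨T, rfl⟩ := b.equivFun.surjective v
      have h1 : b.equivFun T ∈ (conjCommutant E).map b.equivFun.toLinearMap ↔
          T ∈ conjCommutant E := by
        constructor
        · rintro ⟨T', hT', h⟩
          exact b.equivFun.injective h ▸ hT'
        · exact fun h => ⟨T, h, rfl⟩
      rw [h1]
      refine forall₂_congr fun u _ => ?_
      rw [← conjEnd_apply_eq_iff]
      have h2 : LinearMap.toMatrix b b (conjEnd u) *ᵥ b.equivFun T =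
          b.equivFun (conjEnd u T) := LinearMap.toMatrix_mulVec_repr b b (conjEnd u) T
      rw [h2, b.equivFun.injective.eq_iff])
  have htr : ∀ u : QubitUnitary n, (LinearMap.toMatrix b b (conjEnd u)).trace =
      ((‖(u : Op n).trace‖ ^ 4 : ℝ) : ℂ) := fun u => by
    rw [← LinearMap.trace_eq_matrix_trace, trace_conjEnd]
  simp only [htr] at key
  rw [LinearEquiv.finrank_map_eq] at key
  have hre := integral_ofReal (𝕜 := ℂ) (μ := μ) (f := fun u : QubitUnitary n => ‖(u : Op n).trace‖ ^ 4)
  rw [show ∫ u : QubitUnitary n, ((‖(u : Op n).trace‖ ^ 4 : ℝ) : ℂ) ∂μ = _ from hre] at key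
  exact Complex.ofReal_injective (key.trans (Complex.ofReal_natCast _).symm)

theorem framePotential_two {μ : Measure (QubitUnitary n)} {E : Set (QubitUnitary n)}
    (hμ : IsUniformOn μ E) :
    framePotential 2 μ = Module.finrank ℂ (conjCommutant E) := by
  have := hμ.isProbabilityMeasure
  rw [← integral_norm_trace_pow hμ, framePotential]
  have hae : ∀ᵐ u ∂μ, u ∈ E := hμ.compl_eq_zero
  have hin : ∀ᵐ u : QubitUnitary n ∂μ, ∫ v, ‖Matrix.trace ((u : Op n) * (v : Op n)ᴴ)‖ ^ (2 * 2) ∂μ =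
      ∫ v : QubitUnitary n, ‖(v : Op n).trace‖ ^ 4 ∂μ := by
    filter_upwards [hae] with u hu
    -- Substituting `u * v` for `v` turns `tr (u vᴴ)` into `tr (u vᴴ uᴴ)`, the conjugate of `tr v`.
    have h2 := (Homeomorph.mulLeft u).toMeasurableEquiv.measurableEmbedding.integral_map
      (μ := μ) (fun v : QubitUnitary n => ‖Matrix.trace ((u : Op n) * (v : Op n)ᴴ)‖ ^ (2 * 2))
    change ∫ v, _ ∂(μ.map (fun v => u * v)) = ∫ v : QubitUnitary n,
      ‖Matrix.trace ((u : Op n) * ((u * v : QubitUnitary n) : Op n)ᴴ)‖ ^ (2 * 2) ∂μ at h2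
    rw [hμ.map_mul_left u hu] at h2
    rw [h2]
    refine integral_congr_ae (Filter.Eventually.of_forall fun v => ?_)
    have h3 : Matrix.trace ((u : Op n) * ((u * v : QubitUnitary n) : Op n)ᴴ) =
        star (v : Op n).trace := by
      have h4 : (u : Op n)ᴴ * (u : Op n) = 1 := Unitary.star_mul_self_of_mem u.2
      rw [Submonoid.coe_mul, Matrix.conjTranspose_mul, Matrix.trace_mul_comm, mul_assoc, h4,
        mul_one, Matrix.trace_conjTranspose]
    simp only [h3, norm_star]
  rw [integral_congr_ae hin]
  simp

/-! ### Extending commutation from generators to the closed group and to the Lie algebra. -/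

/-- The unitaries whose conjugation commutes with a linear map on operators. -/
noncomputable def conjCentralizer (T : Module.End ℂ (Op n)) : Subgroup (QubitUnitary n) where
  carrier := {u | conjOp u * T = T * conjOp u}
  mul_mem' := fun {u v} hu hv => by
    change conjOp (u * v) * T = T * conjOp (u * v)
    rw [conjOp_mul, mul_assoc, hv, ← mul_assoc, hu, mul_assoc]
  one_mem' := by
    change conjOp 1 * T = T * conjOp 1
    rw [conjOp_one, one_mul, mul_one]
  inv_mem' := fun {u} hu => by
    change conjOp u⁻¹ * T = T * conjOp u⁻¹
    have h1 : conjOp u⁻¹ * conjOp u = 1 := by rw [← conjOp_mul, inv_mul_cancel, conjOp_one]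
    have h2 : conjOp u * conjOp u⁻¹ = 1 := by rw [← conjOp_mul, mul_inv_cancel, conjOp_one]
    calc conjOp u⁻¹ * T = conjOp u⁻¹ * (T * conjOp u) * conjOp u⁻¹ := by
          rw [mul_assoc, mul_assoc, h2, mul_one]
      _ = T * conjOp u⁻¹ := by
          rw [← show conjOp u * T = T * conjOp u from hu, ← mul_assoc, h1, one_mul]

theorem isClosed_conjCentralizer (T : Module.End ℂ (Op n)) :
    IsClosed (conjCentralizer T : Set (QubitUnitary n)) := by
  have h : (conjCentralizer T : Set (QubitUnitary n)) =
      ⋂ A : Op n, {u | T (conjOp u A) = conjOp u (T A)} := by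
    ext u
    rw [Set.mem_iInter]
    change conjOp u * T = T * conjOp u ↔ _
    rw [eq_comm, LinearMap.ext_iff]
    rfl
  rw [h]
  exact isClosed_iInter fun A => isClosed_eq
    ((LinearMap.continuous_of_finiteDimensional T).comp (continuous_conjOp_apply A))
    (continuous_conjOp_apply (T A))

/-- The unitaries whose conjugation commutes with `T` form a closed subgroup, so passing to the
generated closed subgroup adds no condition on `T`. -/
theorem conjCommutant_compactGroup (𝔤 : LieSubalgebra ℝ (Op n)) :
    conjCommutant (compactGroup 𝔤 : Set (QubitUnitary n)) = conjCommutant (expSet 𝔤) := by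
  ext T
  constructor
  · intro hT u hu
    exact hT u (Subgroup.le_topologicalClosure _ (Subgroup.subset_closure hu))
  · intro hT u hu
    have : compactGroup 𝔤 ≤ conjCentralizer T :=
      Subgroup.topologicalClosure_minimal _ ((Subgroup.closure_le _).mpr fun u hu => hT u hu)
        (isClosed_conjCentralizer T)
    exact this hu

/-- The operators `A` such that `[A, ·]` commutes with a given linear map on operators. -/
noncomputable def adCentralizer (T : Module.End ℂ (Op n)) : LieSubalgebra ℝ (Op n) where
  carrier := {A | ∀ M, T (A * M - M * A) = A * T M - T M * A}
  add_mem' := fun {A B} hA hB M => by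
    have h : (A + B) * M - M * (A + B) = (A * M - M * A) + (B * M - M * B) := by noncomm_ring
    rw [h, map_add, hA, hB]
    noncomm_ring
  zero_mem' := fun M => by simp
  smul_mem' := fun c A hA M => by
    rw [smul_mul_assoc, mul_smul_comm, ← smul_sub, LinearMap.map_smul_of_tower, hA, smul_sub,
      smul_mul_assoc, mul_smul_comm]
  lie_mem' := fun {A B} hA hB M => by
    have h : ⁅A, B⁆ * M - M * ⁅A, B⁆ = (A * (B * M - M * B) - (B * M - M * B) * A) -
        (B * (A * M - M * A) - (A * M - M * A) * B) := by
      rw [Ring.lie_def]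
      noncomm_ring
    have h1 : T (A * (B * M - M * B) - (B * M - M * B) * A) =
        A * T (B * M - M * B) - T (B * M - M * B) * A := hA _
    have h2 : T (B * (A * M - M * A) - (A * M - M * A) * B) =
        B * T (A * M - M * A) - T (A * M - M * A) * B := hB _
    have h3 : T (A * M - M * A) = A * T M - T M * A := hA M
    have h4 : T (B * M - M * B) = B * T M - T M * B := hB M
    rw [h, map_sub, h1, h2, h3, h4, Ring.lie_def]
    noncomm_ring

theorem mem_adCentralizer_of_adCommutant {𝒢 : Set (PauliString n)} {T : Module.End ℂ (Op n)}
    (hT : T ∈ PauliString.adCommutant 𝒢) : dla 𝒢 ≤ adCentralizer T := by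
  refine LieSubalgebra.lieSpan_le.mpr ?_
  rintro _ ⟨X, hX, rfl⟩ M
  have h := hT X hX M
  have h1 : ∀ M : Op n, (Complex.I • X.toOp) * M - M * (Complex.I • X.toOp) =
      -(Complex.I • (M * X.toOp - X.toOp * M)) := fun M => by
    rw [smul_mul_assoc, mul_smul_comm, smul_sub]
    abel
  rw [h1, h1, map_neg, map_smul, h]

/-! ### Exponentials and conjugation. -/

/-- If `t` commutes with `[a, ·]`, it commutes with the conjugation by `exp a`. -/
theorem NormedSpace.map_exp_conj {𝔸 : Type*} [NormedRing 𝔸] [NormedAlgebra ℂ 𝔸] [CompleteSpace 𝔸]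
    (t : 𝔸 →L[ℂ] 𝔸) {a : 𝔸} (ha : ∀ m, t (a * m - m * a) = a * t m - t m * a) (m : 𝔸) :
    t (exp a * m * exp (-a)) = exp a * t m * exp (-a) := by
  let _ : NormedAlgebra ℚ 𝔸 := NormedAlgebra.restrictScalars ℚ ℂ 𝔸
  let _ : NormedAlgebra ℚ (𝔸 →L[ℂ] 𝔸) := NormedAlgebra.restrictScalars ℚ ℂ (𝔸 →L[ℂ] 𝔸)
  -- `l + r` is `[a, ·]`. As `l` and `r` commute, `exp (l + r) = exp l * exp r` is conjugation by
  -- `exp a`.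
  let l : 𝔸 →L[ℂ] 𝔸 := ContinuousLinearMap.mul ℂ 𝔸 a
  let r : 𝔸 →L[ℂ] 𝔸 := (ContinuousLinearMap.mul ℂ 𝔸).flip (-a)
  have hlr : Commute l r := by
    refine ContinuousLinearMap.ext fun m => ?_
    simp [l, r, mul_assoc]
  have hl : ∀ m, exp l m = exp a * m := by
    let f : 𝔸 →+* (𝔸 →L[ℂ] 𝔸) :=
      { toFun := fun b => ContinuousLinearMap.mul ℂ 𝔸 b
        map_zero' := map_zero _
        map_add' := map_add _
        map_one' := by ext m; simp
        map_mul' := fun b c => by ext m; simp [mul_assoc] }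
    have h : f (exp a) = exp l := map_exp f (ContinuousLinearMap.mul ℂ 𝔸).continuous a
    intro m
    rw [← h]
    rfl
  have hr : ∀ m, exp r m = m * exp (-a) := by
    -- Right multiplication reverses products, so it is a ring homomorphism on the opposite algebra.
    let f : 𝔸ᵐᵒᵖ →+* (𝔸 →L[ℂ] 𝔸) :=
      { toFun := fun b => (ContinuousLinearMap.mul ℂ 𝔸).flip b.unop
        map_zero' := map_zero _
        map_add' := fun b c => map_add _ _ _
        map_one' := by ext m; simp
        map_mul' := fun b c => by ext m; simp [mul_assoc] }
    have h : f (exp (MulOpposite.op (-a))) = exp r :=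
      map_exp f ((ContinuousLinearMap.mul ℂ 𝔸).flip.continuous.comp
        MulOpposite.continuous_unop) _
    intro m
    rw [← h, exp_op]
    rfl
  have ht : Commute (l + r) t := by
    refine ContinuousLinearMap.ext fun m => ?_
    have h := ha m
    simp only [l, r, ContinuousLinearMap.mul_apply', ContinuousLinearMap.mul_def,
      ContinuousLinearMap.comp_apply, _root_.add_apply,
      ContinuousLinearMap.flip_apply, mul_neg, ← sub_eq_add_neg, h]
  have h := ht.exp_left.eq
  rw [exp_add_of_commute hlr] at h
  have h2 := congrArg (fun f : 𝔸 →L[ℂ] 𝔸 => f m) h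
  simp only [ContinuousLinearMap.mul_def, ContinuousLinearMap.comp_apply, hl, hr] at h2
  simpa [mul_assoc] using h2.symm

/-- Euler's formula for a square root of `-1`. -/
theorem NormedSpace.exp_smul_of_mul_self_eq_neg_one {𝔸 : Type*} [NormedRing 𝔸] [NormedAlgebra ℝ 𝔸]
    [CompleteSpace 𝔸] {y : 𝔸} (hy : y * y = -1) (θ : ℝ) :
    exp (θ • y) = Real.cos θ • (1 : 𝔸) + Real.sin θ • y := by
  let _ : NormedAlgebra ℚ 𝔸 := NormedAlgebra.restrictScalars ℚ ℝ 𝔸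
  -- The homomorphism sending `Complex.I` to `y` carries Euler's formula from `ℂ` to `𝔸`.
  let f : ℂ →ₐ[ℝ] 𝔸 := Complex.lift ⟨y, hy⟩
  have hf : ∀ z : ℂ, f z = z.re • (1 : 𝔸) + z.im • y := fun z => by
    simp [f, Complex.liftAux_apply, Algebra.algebraMap_eq_smul_one]
  have h := map_exp f
    (LinearMap.continuous_of_finiteDimensional f.toLinearMap) (θ * Complex.I)
  rw [← Complex.exp_eq_exp_ℂ, hf, hf, Complex.exp_ofReal_mul_I_re,
    Complex.exp_ofReal_mul_I_im] at h
  simpa using h.symm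

theorem map_exp_conj {T : Module.End ℂ (Op n)} {A : Op n} (hA : A ∈ adCentralizer T) (M : Op n) :
    T (NormedSpace.exp A * M * NormedSpace.exp (-A)) =
      NormedSpace.exp A * T M * NormedSpace.exp (-A) :=
  open scoped Matrix.Norms.Operator in
  NormedSpace.map_exp_conj (LinearMap.toContinuousLinearMap T) hA M

theorem exp_smul_of_mul_self_eq_neg_one {Y : Op n} (hY : Y * Y = -1) (θ : ℝ) :
    NormedSpace.exp (θ • Y) = Real.cos θ • (1 : Op n) + Real.sin θ • Y :=
  open scoped Matrix.Norms.Operator in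
  NormedSpace.exp_smul_of_mul_self_eq_neg_one hY θ

theorem conjTranspose_eq_exp_neg {u : QubitUnitary n} {A : Op n}
    (h : (u : Op n) = NormedSpace.exp A) : (u : Op n)ᴴ = NormedSpace.exp (-A) := by
  have h1 : (u : Op n)ᴴ * (u : Op n) = 1 := Unitary.star_mul_self_of_mem u.2
  have h2 : (u : Op n) * NormedSpace.exp (-A) = 1 := by
    rw [h, ← Matrix.exp_add_of_commute _ _ (Commute.refl A).neg_right, add_neg_cancel,
      NormedSpace.exp_zero]
  calc (u : Op n)ᴴ = (u : Op n)ᴴ * ((u : Op n) * NormedSpace.exp (-A)) := by rw [h2, mul_one]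
    _ = _ := by rw [← mul_assoc, h1, one_mul]

theorem exists_unitary_expSet {𝒢 : Set (PauliString n)} {X : PauliString n} (hX : X ∈ 𝒢) (θ : ℝ) :
    ∃ u ∈ expSet (dla 𝒢),
      (u : Op n) = Real.cos θ • (1 : Op n) + Real.sin θ • (Complex.I • X.toOp) := by
  have hX2 := X.toOp_sq
  have hY : (Complex.I • X.toOp) * (Complex.I • X.toOp) = -1 := by
    rw [smul_mul_assoc, mul_smul_comm, hX2, smul_smul, Complex.I_mul_I, neg_smul, one_smul]
  have hYs : star (Complex.I • X.toOp) = -(Complex.I • X.toOp) := by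
    rw [star_smul, Matrix.star_eq_conjTranspose, PauliString.conjTranspose_toOp]
    simp
  let U : Op n := Real.cos θ • (1 : Op n) + Real.sin θ • (Complex.I • X.toOp)
  have hU : U ∈ Matrix.unitaryGroup (Qubits n) ℂ := by
    rw [Matrix.mem_unitaryGroup_iff]
    have hs : star U = Real.cos θ • (1 : Op n) - Real.sin θ • (Complex.I • X.toOp) := by
      simp only [U, star_add, star_smul, hYs, star_one, star_trivial]
      module
    have h1 : ∀ (a b : ℝ) (Y : Op n), (a • 1 + b • Y) * (a • 1 - b • Y) =
        (a ^ 2) • (1 : Op n) - (b ^ 2) • (Y * Y) := fun a b Y => by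
      simp only [add_mul, mul_sub, smul_mul_assoc, mul_smul_comm, one_mul, mul_one]
      module
    rw [hs, h1, hY, smul_neg, sub_neg_eq_add, ← add_smul, Real.cos_sq_add_sin_sq, one_smul]
  refine ⟨⟨U, hU⟩, ⟨θ • (Complex.I • X.toOp), ?_, ?_⟩, rfl⟩
  · exact (dla 𝒢).smul_mem θ (LieSubalgebra.subset_lieSpan ⟨X, hX, rfl⟩)
  · exact (exp_smul_of_mul_self_eq_neg_one hY θ).symm

/-- From group to algebra no derivative is needed: the two rotations `exp (± i π X / 4)` determine
`[X, ·]`. Conversely, commuting with the brackets of the generators passes to all of `dla 𝒢` and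
then to exponentials. -/
theorem conjCommutant_expSet_dla (𝒢 : Set (PauliString n)) :
    conjCommutant (expSet (dla 𝒢)) = PauliString.adCommutant 𝒢 := by
  ext T
  constructor
  · intro hT X hX M
    have hX2 := X.toOp_sq
    set s : ℝ := √2 / 2
    have hs : s * s = 1 / 2 := by
      have : √2 * √2 = 2 := Real.mul_self_sqrt (by norm_num)
      simp only [s]
      linear_combination this / 4
    -- For `u = s + σ i X` one has `u M uᴴ = s² M + s σ i [X, M] + σ² X M X`. Subtracting the cases
    -- `σ = s` and `σ = -s` leaves `2 s² i [X, M] = i [X, M]`.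
    have key : ∀ σ : ℝ, (∃ u ∈ expSet (dla 𝒢),
        (u : Op n) = s • (1 : Op n) + σ • (Complex.I • X.toOp)) → ∀ M,
        (s * σ * Complex.I) • T (X.toOp * M - M * X.toOp) + (σ * σ : ℂ) • T (X.toOp * M * X.toOp) =
        (s * σ * Complex.I) • (X.toOp * T M - T M * X.toOp) +
          (σ * σ : ℂ) • (X.toOp * T M * X.toOp) := by
      rintro σ ⟨u, hu, hueq⟩ M
      have hustar : (u : Op n)ᴴ = s • (1 : Op n) - σ • (Complex.I • X.toOp) := by
        rw [hueq, Matrix.conjTranspose_add, Matrix.conjTranspose_smul, Matrix.conjTranspose_smul,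
          Matrix.conjTranspose_smul, PauliString.conjTranspose_toOp]
        simp [sub_eq_add_neg]
      have hc : ∀ M, conjOp u M = (s * s : ℂ) • M +
          ((s * σ * Complex.I) • (X.toOp * M - M * X.toOp) +
            (σ * σ : ℂ) • (X.toOp * M * X.toOp)) := by
        intro M
        rw [conjOp_apply, hustar, hueq]
        simp only [add_mul, mul_sub, smul_mul_assoc, mul_smul_comm, one_mul, mul_one,
          ← Complex.coe_smul]
        match_scalars <;> ring_nf
        simp
      have h := LinearMap.congr_fun (hT u hu) M
      simp only [Module.End.mul_apply, hc, map_add, map_smul] at h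
      exact (add_left_cancel h).symm
    have hp := key s (by
      have := exists_unitary_expSet hX (Real.pi / 4)
      rwa [Real.cos_pi_div_four, Real.sin_pi_div_four] at this) M
    have hm := key (-s) (by
      have := exists_unitary_expSet hX (-(Real.pi / 4))
      rwa [Real.cos_neg, Real.sin_neg, Real.cos_pi_div_four, Real.sin_pi_div_four] at this) M
    have hsc : (s : ℂ) * s = 1 / 2 := by
      rw [← Complex.ofReal_mul, hs]
      norm_num
    have h3 : Complex.I • T (X.toOp * M - M * X.toOp) =
        Complex.I • (X.toOp * T M - T M * X.toOp) := by
      have h4 := congrArg₂ (· - ·) hp hm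
      simp only [Complex.ofReal_neg, mul_neg, neg_mul, neg_neg, hsc, neg_smul] at h4
      calc _ = _ := ?_
        _ = _ := h4
        _ = _ := ?_
      · module
      · module
    have h5 := smul_right_injective _ Complex.I_ne_zero h3
    rw [← neg_sub, map_neg, h5, neg_sub]
  · rintro hT u ⟨A, hA, hu⟩
    refine LinearMap.ext fun M => ?_
    rw [Module.End.mul_apply, Module.End.mul_apply, conjOp_apply, conjOp_apply,
      conjTranspose_eq_exp_neg hu, hu, map_exp_conj (mem_adCentralizer_of_adCommutant hT hA)]

/-! ### Haar measure and the conclusion. -/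

theorem isUniformOn_haarEnsemble (G : Subgroup (QubitUnitary n)) [CompactSpace G] :
    IsUniformOn (haarEnsemble G) (G : Set (QubitUnitary n)) where
  isProbabilityMeasure := by
    have : IsProbabilityMeasure
        (Measure.haarMeasure (⊤ : TopologicalSpace.PositiveCompacts G)) :=
      ⟨Measure.haarMeasure_self⟩
    exact Measure.isProbabilityMeasure_map measurable_subtype_coe.aemeasurable
  compl_eq_zero := by
    have hc : IsClosed (G : Set (QubitUnitary n)) :=
      (isCompact_iff_compactSpace.mpr ‹CompactSpace G›).isClosed
    rw [haarEnsemble, Measure.map_apply measurable_subtype_coe hc.measurableSet.compl]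
    have h : (Subtype.val : G → QubitUnitary n) ⁻¹' (G : Set (QubitUnitary n))ᶜ = ∅ := by
      ext x
      simp
    rw [h, measure_empty]
  map_mul_left := fun u hu => by
    rw [haarEnsemble, Measure.map_map (measurable_const_mul u) measurable_subtype_coe]
    have h : (fun v => u * v) ∘ (Subtype.val : G → QubitUnitary n) =
        Subtype.val ∘ fun v : G => (⟨u, hu⟩ : G) * v := rfl
    rw [h, ← Measure.map_map measurable_subtype_coe (measurable_const_mul _),
      map_mul_left_eq_self]

end Conjugation

theorem proposition1 (n : ℕ) (𝒢 : Set (PauliString n))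
    (h𝔤 : HasPauliBasis (dla 𝒢))
    (hL : SpaceHasPauliBasis (linearSymmetries (expSet (dla 𝒢)))) :
    framePotential 2 (haarEnsemble (compactGroup (dla 𝒢)))
        = ({p : PauliString n | (commutatorGraph 𝒢).IsIsolated p}.ncard : ℝ)
          * (Nat.card (commutatorGraph 𝒢).ConnectedComponent : ℝ) ∧
      ∀ μ : Measure (QubitUnitary n), IsUniformOn μ (expSet (dla 𝒢)) →
        framePotential 2 μ
          = ({p : PauliString n | (commutatorGraph 𝒢).IsIsolated p}.ncard : ℝ)
            * (Nat.card (commutatorGraph 𝒢).ConnectedComponent : ℝ) := by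
  have hdim : (Module.finrank ℂ (conjCommutant (expSet (dla 𝒢))) : ℝ) =
      ({p : PauliString n | (commutatorGraph 𝒢).IsIsolated p}.ncard : ℝ)
        * (Nat.card (commutatorGraph 𝒢).ConnectedComponent : ℝ) := by
    rw [conjCommutant_expSet_dla, PauliString.finrank_adCommutant, Nat.cast_mul]
  constructor
  · rw [framePotential_two (isUniformOn_haarEnsemble _), conjCommutant_compactGroup, hdim]
  · intro μ hμ
    rw [framePotential_two hμ, hdim]
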